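/- Let $\mathbb D$ be the open unit disc of $\mathbb C$ and $\mathbb T=\partial\mathbb D$. Let $H^2$ be the Hardy space of all functions $f(z)=\sum_{n\ge 0}a_nz^n$ on $\mathbb D$ with $\|f\|_{H^2}^2=\sum_{n\ge 0}|a_n|^2<\infty$, which is a Hilbert space for this norm. Let $E\subset\mathbb T$ be a closed set of Lebesgue measure zero. Then there exists a function $\varphi$ in the disc algebra, that is, $\varphi$ is continuous on $\overline{\mathbb D}$ and holomorphic on $\mathbb D$, with $\varphi(\mathbb D)\subset\mathbb D$, such that the composition operator $C_\varphi f=f\circ\varphi$ is a Hilbert–Schmidt operator on $H^2$ (that is, it is a bounded operator from $H^2$ to $H^2$ and $\sum_i\|C_\varphi e_i\|_{H^2}^2<\infty$ for an orthonormal basis $(e_i)$ of $H^2$) and $$E_\varphi(1):=\{\zeta\in\mathbb T:\ |\varphi(\zeta)|\ge 1\}=E .$$ -/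

import Mathlib

open Complex MeasureTheory Metric Set
open scoped UnitDisc ENNReal

noncomputable section

/-- A function belongs to the disc algebra when it is holomorphic on the open unit disc and
continuous on the closed unit disc (values outside the closed disc are irrelevant). -/
def MemDiscAlgebra (φ : ℂ → ℂ) : Prop :=
  DifferentiableOn ℂ φ (ball 0 1) ∧ ContinuousOn φ (closedBall 0 1)

/-- The level set `{ζ ∈ 𝕋 : |φ(ζ)| ≥ s}`. -/
def levelSet (φ : ℂ → ℂ) (s : ℝ) : Set Circle :=
  {ζ : Circle | s ≤ ‖φ (ζ : ℂ)‖}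

/-- Lebesgue measure (arc length) of a subset of the unit circle: the measure of its set of
arguments in `(-π, π]`. -/
def arcLength (E : Set Circle) : ℝ≥0∞ :=
  volume {t : ℝ | t ∈ Ioc (-Real.pi) Real.pi ∧ Circle.exp t ∈ E}

/-- The power series `∑ aₙ zⁿ` with square summable coefficients converges on the disc. -/
theorem summable_hardy_series (a : lp (fun _ : ℕ => ℂ) 2) (z : 𝔻) :
    Summable fun n : ℕ => a n * (z : ℂ) ^ n := by
  refine Summable.of_norm_bounded
    (g := fun n : ℕ => ‖a‖ * ‖(z : ℂ)‖ ^ n)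
    ((summable_geometric_of_lt_one (norm_nonneg _) z.norm_lt_one).mul_left _) ?_
  intro n
  rw [norm_mul, norm_pow]
  exact mul_le_mul_of_nonneg_right (lp.norm_apply_le_norm (by norm_num) a n) (by positivity)

/-- The map `(aₙ) ↦ (z ↦ ∑ aₙ zⁿ)` from `ℓ²` to functions on the open unit disc. -/
def hardySeries : lp (fun _ : ℕ => ℂ) 2 →ₗ[ℂ] (𝔻 → ℂ) where
  toFun a z := ∑' n : ℕ, a n * (z : ℂ) ^ n
  map_add' a b := by
    funext z
    simp only [lp.coeFn_add, Pi.add_apply, add_mul]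
    exact (summable_hardy_series a z).tsum_add (summable_hardy_series b z)
  map_smul' c a := by
    funext z
    simp only [lp.coeFn_smul, Pi.smul_apply, smul_eq_mul, mul_assoc, RingHom.id_apply]
    exact tsum_mul_left

/-- A function on the disc determines its Taylor coefficients. -/
theorem hardySeries_injective : Function.Injective hardySeries := by
  rw [← LinearMap.ker_eq_bot, LinearMap.ker_eq_bot']
  intro a ha
  have hp : HasFPowerSeriesAt (fun _ : ℂ => (0 : ℂ))
      (FormalMultilinearSeries.ofScalars ℂ (fun n => a n)) 0 := by
    rw [hasFPowerSeriesAt_iff]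
    filter_upwards [ball_mem_nhds (0 : ℂ) one_pos] with z hz
    have hz' : ‖z‖ < 1 := by simpa using hz
    have h := (summable_hardy_series a (UnitDisc.mk z hz')).hasSum
    have h0 := congrFun ha (UnitDisc.mk z hz')
    simp only [hardySeries, LinearMap.coe_mk, AddHom.coe_mk, Pi.zero_apply] at h0
    rw [h0] at h
    simpa [FormalMultilinearSeries.coeff_ofScalars, mul_comm] using h
  have hz := hp.eq_zero
  ext n
  have h := congrArg (fun p => FormalMultilinearSeries.coeff p n) hz
  have h' : FormalMultilinearSeries.coeff (0 : FormalMultilinearSeries ℂ ℂ ℂ) n = 0 := rfl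
  simpa [FormalMultilinearSeries.coeff_ofScalars, h'] using h

/-- The Hardy space `H²` of the unit disc: all functions `f(z) = ∑ aₙ zⁿ` on the disc with
`∑ |aₙ|² < ∞`. (A separate type, since it does not carry the topology of pointwise convergence.) -/
def HardySpace : Type := ↥(LinearMap.range hardySeries)

namespace HardySpace

instance : AddCommGroup HardySpace := inferInstanceAs (AddCommGroup (LinearMap.range hardySeries))

instance : Module ℂ HardySpace := inferInstanceAs (Module ℂ (LinearMap.range hardySeries))

/-- Elements of `H²` are functions on the open unit disc. -/
instance : CoeFun HardySpace (fun _ => 𝔻 → ℂ) := ⟨Subtype.val⟩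

/-- The sequence of Taylor coefficients at `0` of a function in `H²`. -/
def coeffs : HardySpace ≃ₗ[ℂ] lp (fun _ : ℕ => ℂ) 2 :=
  (LinearEquiv.ofInjective hardySeries hardySeries_injective).symm

/-- Every `f ∈ H²` is the sum of its Taylor series. -/
theorem hasSum_coeffs (f : HardySpace) (z : 𝔻) :
    HasSum (fun n : ℕ => coeffs f n * (z : ℂ) ^ n) (f z) := by
  have h : hardySeries (coeffs f) = f.val :=
    congrArg Subtype.val
      ((LinearEquiv.ofInjective hardySeries hardySeries_injective).apply_symm_apply f)
  rw [← h]
  exact (summable_hardy_series (coeffs f) z).hasSum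

/-- The inner product `⟪f, g⟫ = ∑ conj(aₙ) bₙ` of `f = ∑ aₙ zⁿ` and `g = ∑ bₙ zⁿ`
(conjugate linear in the first variable, as everywhere in the library). -/
abbrev innerCore : InnerProductSpace.Core ℂ HardySpace where
  inner f g := inner ℂ (coeffs f) (coeffs g)
  conj_inner_symm f g := inner_conj_symm (coeffs f) (coeffs g)
  re_inner_nonneg f := inner_self_nonneg (𝕜 := ℂ) (x := coeffs f)
  add_left f g h := by rw [map_add]; exact inner_add_left _ _ _
  smul_left f g r := by rw [map_smul]; exact inner_smul_left _ _ _
  definite f hf := by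
    have h : coeffs f = 0 := inner_self_eq_zero.mp hf
    exact (LinearEquiv.map_eq_zero_iff coeffs).mp h

instance : NormedAddCommGroup HardySpace := innerCore.toNormedAddCommGroup

instance : InnerProductSpace ℂ HardySpace := InnerProductSpace.ofCore innerCore.toCore

theorem norm_coeffs (f : HardySpace) : ‖coeffs f‖ = ‖f‖ := by
  have h : inner ℂ (coeffs f) (coeffs f) = inner ℂ f f := rfl
  rw [inner_self_eq_norm_sq_to_K, inner_self_eq_norm_sq_to_K] at h
  exact (pow_left_inj₀ (norm_nonneg _) (norm_nonneg _) two_ne_zero).mp (by exact_mod_cast h)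

/-- Taking Taylor coefficients is an isometry of `H²` onto `ℓ²`. -/
def coeffsIsometry : HardySpace ≃ₗᵢ[ℂ] lp (fun _ : ℕ => ℂ) 2 := ⟨coeffs, norm_coeffs⟩

instance : CompleteSpace HardySpace :=
  coeffsIsometry.toIsometryEquiv.completeSpace

/-- The norm is `‖f‖² = ∑ |aₙ|²`. -/
theorem norm_sq_eq (f : HardySpace) : ‖f‖ ^ 2 = ∑' n : ℕ, ‖coeffs f n‖ ^ 2 := by
  rw [← norm_coeffs]
  simpa using lp.norm_rpow_eq_tsum (p := 2) (by norm_num) (coeffs f)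

end HardySpace

/-- A bounded operator on a Hilbert space is Hilbert–Schmidt when `∑ ‖T bᵢ‖² < ∞` for an
orthonormal basis `(bᵢ)`; the sum does not depend on the basis. -/
def IsHilbertSchmidt {H : Type} [NormedAddCommGroup H] [InnerProductSpace ℂ H]
    (T : H →L[ℂ] H) : Prop :=
  ∃ (ι : Type) (b : HilbertBasis ι ℂ H), Summable fun i => ‖T (b i)‖ ^ 2

/-- `T` is the composition operator `C_φ f = f ∘ φ` on `H²`, for a self-map `φ` of the disc. -/
def IsCompositionOperator (φ : ℂ → ℂ) (hφ : ∀ z : 𝔻, ‖φ (z : ℂ)‖ < 1)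
    (T : HardySpace →L[ℂ] HardySpace) : Prop :=
  ∀ (f : HardySpace) (z : 𝔻), T f z = f (UnitDisc.mk (φ (z : ℂ)) (hφ z))

end

/-! By Parseval, the Hilbert–Schmidt sum for the basis `zⁿ` is `∑ ‖φⁿ‖²`, the mean of `1 / (1 -
|φ|²)` over the circle. It is finite as soon as `1 / (1 - |φ|²) ≤ Re H` with `H` holomorphic on the
disc, because the means of `Re H` over all circles of radius `r < 1` equal `Re H(0)`. This is
`exists_isHilbertSchmidt_of_harmonic_majorant`.

The symbol is `φ = 1 - 1/(2F)` with `Re F ≥ 1` and `Re F → ∞` exactly at `E`. Then `|φ| < 1` off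
`E`, `φ` extends continuously by `1` to `E`, and `1 / (1 - |φ|²) ≤ (4/3)|F|²`. Since `|F|² = 2 (Re
F)² - Re (F²)`, it remains to dominate `(Re F)²` by some `Re G`.

Take `F = 1 + ∑ f_k` and `G = 1 + ∑ (4k+4) f_k`, where the `f_k` come from
`exists_disc_algebra_bump`. The bounds `0 ≤ Re f_k ≤ 2` give `(Re F)² ≤ Re G` (`sq_one_add_sum_le`),
the lower bound on `E` forces divergence there, and smallness away from `E` makes both series
converge locally uniformly.

Each bump is an average of Cauchy kernels with poles just outside the disc, near those vertices of a
regular `N`-gon that are close to `E`. Because `E` is closed and null, these vertices form an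
arbitrarily small proportion of all `N`, hence the smallness away from `E`; the average over all
vertices is explicit and bounded, hence the upper bound on the real part. -/

/-! ### Circle means and Taylor coefficients -/

/-- A power series converging on the open unit disc has a holomorphic sum. -/
theorem differentiableOn_of_hasSum_pow {a : ℕ → ℂ} {g : ℂ → ℂ}
    (hg : ∀ z ∈ ball (0 : ℂ) 1, HasSum (fun n => a n * z ^ n) (g z)) :
    DifferentiableOn ℂ g (ball 0 1) := by
  have hps : HasFPowerSeriesOnBall g (FormalMultilinearSeries.ofScalars ℂ a) 0 1 := by
    refine ⟨?_, one_pos, ?_⟩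
    · refine ENNReal.le_of_forall_nnreal_lt fun r hr => ?_
      have hr1 : (r : ℝ) < 1 := by exact_mod_cast hr
      have hs := (hg (r : ℂ) (by simpa using hr1)).summable.tendsto_atTop_zero.norm.bddAbove_range
      obtain ⟨C, hC⟩ := hs
      refine FormalMultilinearSeries.le_radius_of_bound _ C fun n => ?_
      have h := hC ⟨n, rfl⟩
      simpa [FormalMultilinearSeries.ofScalars_norm] using h
    · intro y hy
      have hy' : y ∈ ball (0 : ℂ) 1 := by
        simpa [Metric.mem_ball, ← ENNReal.ofReal_one, Metric.eball_ofReal] using hy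
      simpa [FormalMultilinearSeries.ofScalars_apply_eq, mul_comm] using hg y hy'
  have h := hps.differentiableOn
  rwa [← ENNReal.ofReal_one, Metric.eball_ofReal] at h

/-- The mean value property for the real part of a holomorphic function. -/
theorem circleAverage_re_of_differentiableOn {h : ℂ → ℂ} (hh : DifferentiableOn ℂ h (ball 0 1))
    {r : ℝ} (hr0 : 0 ≤ r) (hr1 : r < 1) :
    Real.circleAverage (fun z => (h z).re) 0 r = (h 0).re := by
  have hsub : closedBall (0 : ℂ) r ⊆ ball 0 1 := closedBall_subset_ball hr1
  have hd : DiffContOnCl ℂ h (ball 0 |r|) := by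
    rw [abs_of_nonneg hr0]
    exact (hh.mono hsub).diffContOnCl_ball subset_rfl
  have hi : CircleIntegrable h 0 r :=
    (hh.continuousOn.mono (sphere_subset_closedBall.trans hsub)).circleIntegrable hr0
  have h1 := Complex.reCLM.circleAverage_comp_comm hi
  rw [hd.circleAverage] at h1
  exact h1

/-- Bessel's inequality on circles for power series. -/
theorem sum_sq_le_circleAverage (N : ℕ) {a : ℕ → ℂ} {g : ℂ → ℂ}
    (hg : ∀ z ∈ ball (0 : ℂ) 1, HasSum (fun n => a n * z ^ n) (g z))
    {r : ℝ} (hr0 : 0 ≤ r) (hr1 : r < 1) :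
    ∑ n ∈ Finset.range N, ‖a n‖ ^ 2 * r ^ (2 * n) ≤
      Real.circleAverage (fun z => ‖g z‖ ^ 2) 0 r := by
  induction N generalizing a g with
  | zero => simpa using Real.circleAverage_nonneg_of_nonneg fun z _ => by positivity
  | succ N ih =>
    set q : ℂ → ℂ := fun z => ∑' n, a (n + 1) * z ^ n with hq
    have hqs : ∀ z ∈ ball (0 : ℂ) 1, HasSum (fun n => a (n + 1) * z ^ n) (q z) := by
      intro z hz
      refine Summable.hasSum ?_
      -- Away from `0` the shifted series is the tail of the original one divided by `z`.
      rcases eq_or_ne z 0 with rfl | hz0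
      · exact summable_of_ne_finset_zero (s := {0}) fun n hn => by
          simp [zero_pow (Finset.notMem_singleton.mp hn)]
      · have h := ((summable_nat_add_iff 1).mpr (hg z hz).summable).mul_right z⁻¹
        refine h.congr fun n => ?_
        field_simp
        ring
    have hgq : ∀ z ∈ ball (0 : ℂ) 1, g z = a 0 + z * q z := by
      intro z hz
      have h1 := (hasSum_nat_add_iff' 1).mpr (hg z hz)
      have h2 := (hqs z hz).mul_left z
      have h3 := h1.unique (h2.congr_fun fun n => by ring)
      simp at h3
      rw [← h3]; ring
    have hqd := differentiableOn_of_hasSum_pow hqs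
    have hsub : sphere (0 : ℂ) r ⊆ ball 0 1 :=
      sphere_subset_closedBall.trans (closedBall_subset_ball hr1)
    have hqc : ContinuousOn q (sphere 0 r) := hqd.continuousOn.mono hsub
    -- Expanding `|a₀ + z q|²` on `|z| = r` gives `r²|q|²` plus the real part of this holomorphic
    -- function, whose mean is its value `|a₀|²` at `0`.
    set h : ℂ → ℂ := fun z => starRingEnd ℂ (a 0) * (a 0 + 2 * (z * q z)) with hh
    have hhd : DifferentiableOn ℂ h (ball 0 1) := by
      have : DifferentiableOn ℂ (fun z : ℂ => z) (ball 0 1) := differentiableOn_id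
      exact ((this.mul hqd).const_mul 2 |>.const_add _).const_mul _
    have e1 : Real.circleAverage (fun z => ‖g z‖ ^ 2) 0 r =
        Real.circleAverage (fun z => r ^ 2 • ‖q z‖ ^ 2 + (h z).re) 0 r := by
      refine Real.circleAverage_congr_sphere fun z hz => ?_
      rw [abs_of_nonneg hr0] at hz
      have hzr : ‖z‖ = r := by simpa using hz
      simp only [hgq z (hsub hz), hh, ← hzr, smul_eq_mul]
      simp only [Complex.sq_norm, Complex.normSq_apply]
      simp
      ring
    have i1 : CircleIntegrable (fun z => r ^ 2 • ‖q z‖ ^ 2) 0 r :=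
      ((hqc.norm.pow 2).const_smul (r ^ 2)).circleIntegrable hr0
    have i2 : CircleIntegrable (fun z => (h z).re) 0 r :=
      (Complex.continuous_re.comp_continuousOn (hhd.continuousOn.mono hsub)).circleIntegrable hr0
    rw [e1, Real.circleAverage_fun_add i1 i2, Real.circleAverage_fun_smul,
      circleAverage_re_of_differentiableOn hhd hr0 hr1, Finset.sum_range_succ']
    have h0 : (h 0).re = ‖a 0‖ ^ 2 := by
      simp only [hh, Complex.sq_norm, Complex.normSq_apply]
      simp
    rw [h0]
    have := mul_le_mul_of_nonneg_left (ih hqs) (sq_nonneg r)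
    rw [Finset.mul_sum] at this
    simp only [smul_eq_mul, mul_zero, pow_zero, mul_one]
    refine add_le_add_left (le_trans (le_of_eq ?_) this) _
    exact Finset.sum_congr rfl fun n _ => by ring

/-- If `1 / (1 - |φ|²)` has a harmonic majorant on the disc, then the Taylor coefficients of all
powers of `φ` are jointly square summable. -/
theorem sum_sq_coeff_pow_le {φ H : ℂ → ℂ} (hφ : DifferentiableOn ℂ φ (ball 0 1))
    (hφ1 : ∀ z ∈ ball (0 : ℂ) 1, ‖φ z‖ < 1) (hH : DifferentiableOn ℂ H (ball 0 1))
    (hφH : ∀ z ∈ ball (0 : ℂ) 1, (1 - ‖φ z‖ ^ 2)⁻¹ ≤ (H z).re) {a : ℕ → ℕ → ℂ}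
    (ha : ∀ n, ∀ z ∈ ball (0 : ℂ) 1, HasSum (fun m => a n m * z ^ m) (φ z ^ n)) (M N : ℕ) :
    ∑ n ∈ Finset.range M, ∑ m ∈ Finset.range N, ‖a n m‖ ^ 2 ≤ (H 0).re := by
  have key : ∀ r : ℝ, 0 ≤ r → r < 1 →
      ∑ n ∈ Finset.range M, ∑ m ∈ Finset.range N, ‖a n m‖ ^ 2 * r ^ (2 * m) ≤ (H 0).re := by
    intro r hr0 hr1
    have hsub : sphere (0 : ℂ) r ⊆ ball 0 1 :=
      sphere_subset_closedBall.trans (closedBall_subset_ball hr1)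
    have hi : ∀ n, CircleIntegrable (fun z => ‖φ z ^ n‖ ^ 2) 0 r := fun n =>
      (((hφ.continuousOn.mono hsub).pow n).norm.pow 2).circleIntegrable hr0
    calc _ ≤ ∑ n ∈ Finset.range M, Real.circleAverage (fun z => ‖φ z ^ n‖ ^ 2) 0 r :=
          Finset.sum_le_sum fun n _ => sum_sq_le_circleAverage N (ha n) hr0 hr1
      _ = Real.circleAverage (fun z => ∑ n ∈ Finset.range M, ‖φ z ^ n‖ ^ 2) 0 r :=
          (Real.circleAverage_fun_sum fun n _ => hi n).symm
      _ ≤ Real.circleAverage (fun z => (H z).re) 0 r := by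
          refine Real.circleAverage_mono ?_ ?_ fun z hz => ?_
          · exact (continuousOn_finsetSum _ fun n _ =>
              ((hφ.continuousOn.mono hsub).pow n).norm.pow 2).circleIntegrable hr0
          · exact (Complex.continuous_re.comp_continuousOn
              (hH.continuousOn.mono hsub)).circleIntegrable hr0
          · rw [abs_of_nonneg hr0] at hz
            refine le_trans ?_ (hφH z (hsub hz))
            have hlt : ‖φ z‖ ^ 2 < 1 := pow_lt_one₀ (norm_nonneg _) (hφ1 z (hsub hz)) two_ne_zero
            -- The sum over `n` is a partial sum of the geometric series of `|φ|²`.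
            rw [← tsum_geometric_of_lt_one (by positivity) hlt]
            have hs := summable_geometric_of_lt_one (sq_nonneg ‖φ z‖) hlt
            refine le_trans (le_of_eq ?_) (hs.sum_le_tsum (Finset.range M) fun n _ => by positivity)
            exact Finset.sum_congr rfl fun n _ => by rw [norm_pow, pow_right_comm]
      _ = (H 0).re := circleAverage_re_of_differentiableOn hH hr0 hr1
  -- Only finitely many terms occur, so `r → 1` is a limit of a polynomial.
  have hc : Continuous fun r : ℝ =>
      ∑ n ∈ Finset.range M, ∑ m ∈ Finset.range N, ‖a n m‖ ^ 2 * r ^ (2 * m) := by fun_prop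
  have ht := (hc.tendsto 1).mono_left (nhdsWithin_le_nhds (s := Iio 1))
  simp only [one_pow, mul_one] at ht
  refine le_of_tendsto ht ?_
  filter_upwards [Ioo_mem_nhdsLT (zero_lt_one (α := ℝ))] with r hr
  exact key r hr.1.le hr.2

/-! ### Operators on the Hardy space -/

namespace HardySpace

/-- Evaluation at a point of the disc is bounded on the Hardy space. -/
theorem norm_eval_le (f : HardySpace) (z : 𝔻) : ‖f z‖ ≤ (1 - ‖(z : ℂ)‖)⁻¹ * ‖f‖ := by
  have hg := summable_geometric_of_lt_one (norm_nonneg (z : ℂ)) z.norm_lt_one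
  rw [← (hasSum_coeffs f z).tsum_eq, ← tsum_geometric_of_lt_one (norm_nonneg _) z.norm_lt_one,
    ← tsum_mul_right]
  refine tsum_of_norm_bounded (hg.mul_right ‖f‖).hasSum fun n => ?_
  rw [norm_mul, norm_pow, mul_comm, ← norm_coeffs]
  exact mul_le_mul_of_nonneg_left (lp.norm_apply_le_norm (by norm_num) _ n) (by positivity)

/-- Evaluation at a point of the disc as a continuous linear functional. -/
noncomputable def evalCLM (z : 𝔻) : HardySpace →L[ℂ] ℂ :=
  LinearMap.mkContinuous
    { toFun := fun f => f z
      map_add' := fun _ _ => rfl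
      map_smul' := fun _ _ => rfl } _ fun f => norm_eval_le f z

theorem evalCLM_apply (z : 𝔻) (f : HardySpace) : evalCLM z f = f z := rfl

/-- A square summable sequence is the coefficient sequence of a function in the Hardy space. -/
theorem exists_coeffs_eq {a : ℕ → ℂ} (ha : Summable fun n => ‖a n‖ ^ 2) :
    ∃ f : HardySpace, ∀ n, coeffs f n = a n := by
  have hm : Memℓp a 2 := memℓp_gen (by simpa using ha)
  exact ⟨coeffs.symm ⟨a, hm⟩, fun n => by rw [LinearEquiv.apply_symm_apply]⟩

end HardySpace

/-- If `(eₙ)` is square summable in norm, then `f ↦ ∑ aₙ(f) eₙ` is a bounded operator, where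
`aₙ(f)` are the Taylor coefficients of `f`. -/
theorem HardySpace.exists_clm_hasSum {e : ℕ → HardySpace} (he : Summable fun n => ‖e n‖ ^ 2) :
    ∃ T : HardySpace →L[ℂ] HardySpace, ∀ f, HasSum (fun n => coeffs f n • e n) (T f) := by
  have hcs : ∀ f : HardySpace, (Summable fun n => ‖coeffs f n‖ * ‖e n‖) ∧
      ∑' n, ‖coeffs f n‖ * ‖e n‖ ≤ √(∑' n, ‖e n‖ ^ 2) * ‖f‖ := by
    intro f
    have hf : Summable fun n => ‖coeffs f n‖ ^ (2 : ℝ) := by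
      simpa using lp.memℓp (coeffs f) |>.summable (by norm_num)
    have h := Real.summable_and_inner_le_Lp_mul_Lq_tsum_of_nonneg Real.HolderConjugate.two_two
      (fun n => norm_nonneg (coeffs f n)) (fun n => norm_nonneg (e n)) hf (by simpa using he)
    refine ⟨h.1, h.2.trans (le_of_eq ?_)⟩
    simp only [Real.rpow_two, ← Real.sqrt_eq_rpow]
    rw [← norm_sq_eq, Real.sqrt_sq (norm_nonneg f), mul_comm]
  have hs : ∀ f : HardySpace, Summable fun n => coeffs f n • e n := fun f =>
    Summable.of_norm (by simpa only [norm_smul] using (hcs f).1)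
  refine ⟨LinearMap.mkContinuous
    { toFun := fun f => ∑' n, coeffs f n • e n
      map_add' := fun f g => ?_
      map_smul' := fun c f => ?_ } (√(∑' n, ‖e n‖ ^ 2)) fun f => ?_, fun f => (hs f).hasSum⟩
  · rw [← (hs f).tsum_add (hs g)]
    simp [add_smul]
  · rw [RingHom.id_apply, ← (hs f).tsum_const_smul c]
    simp [mul_smul]
  · refine le_trans ?_ (hcs f).2
    exact tsum_of_norm_bounded (hcs f).1.hasSum fun n => by rw [norm_smul]

/-- If `1 / (1 - |φ|²)` has a harmonic majorant on the disc, then the composition operator with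
symbol `φ` is Hilbert–Schmidt on the Hardy space. -/
theorem exists_isHilbertSchmidt_of_harmonic_majorant {φ H : ℂ → ℂ}
    (hφ : DifferentiableOn ℂ φ (ball 0 1)) (hφ1 : ∀ z : 𝔻, ‖φ (z : ℂ)‖ < 1)
    (hH : DifferentiableOn ℂ H (ball 0 1))
    (hφH : ∀ z ∈ ball (0 : ℂ) 1, (1 - ‖φ z‖ ^ 2)⁻¹ ≤ (H z).re) :
    ∃ T : HardySpace →L[ℂ] HardySpace, IsCompositionOperator φ hφ1 T ∧ IsHilbertSchmidt T := by
  have hball : ∀ z ∈ ball (0 : ℂ) 1, ‖φ z‖ < 1 := fun z hz =>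
    hφ1 (UnitDisc.mk z (by simpa using hz))
  set a : ℕ → ℕ → ℂ := fun n m => (m.factorial : ℂ)⁻¹ * iteratedDeriv m (φ ^ n) 0
    with ha_def
  have ha : ∀ n, ∀ z ∈ ball (0 : ℂ) 1, HasSum (fun m => a n m * z ^ m) (φ z ^ n) := by
    intro n z hz
    have h := Complex.hasSum_taylorSeries_on_ball (hφ.pow n) hz
    simp only [Pi.pow_apply, smul_eq_mul, sub_zero] at h
    refine h.congr_fun fun m => ?_
    simp only [ha_def]
    ring
  have hbound := sum_sq_coeff_pow_le hφ hball hH hφH ha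
  have hrow : ∀ n, Summable fun m => ‖a n m‖ ^ 2 := by
    intro n
    refine summable_of_sum_range_le (c := (H 0).re) (fun _ => by positivity) fun N => ?_
    refine le_trans ?_ (hbound (n + 1) N)
    exact Finset.single_le_sum (f := fun n => ∑ m ∈ Finset.range N, ‖a n m‖ ^ 2)
      (fun _ _ => by positivity) (Finset.self_mem_range_succ n)
  choose e he using fun n => HardySpace.exists_coeffs_eq (hrow n)
  have hnorm : ∀ n, ‖e n‖ ^ 2 = ∑' m, ‖a n m‖ ^ 2 := fun n => by
    rw [HardySpace.norm_sq_eq]; simp only [he]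
  have hsum : Summable fun n => ‖e n‖ ^ 2 := by
    refine summable_of_sum_range_le (c := (H 0).re) (fun _ => by positivity) fun M => ?_
    simp only [hnorm]
    refine le_of_tendsto' (tendsto_finsetSum (Finset.range M) fun n _ =>
      (hrow n).hasSum.tendsto_sum_nat) fun N => hbound M N
  have heval : ∀ n (z : 𝔻), e n z = φ (z : ℂ) ^ n := by
    intro n z
    refine (HardySpace.hasSum_coeffs (e n) z).unique ?_
    simp only [he]
    exact ha n z (by simpa using z.norm_lt_one)
  obtain ⟨T, hT⟩ := HardySpace.exists_clm_hasSum hsum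
  refine ⟨T, fun f z => ?_, ℕ, HilbertBasis.ofRepr HardySpace.coeffsIsometry, ?_⟩
  -- Evaluation is continuous, so it passes through the series for `T f` and gives `∑ aₙ φ(z)ⁿ`.
  · have h1 := (HardySpace.evalCLM z).hasSum (hT f)
    simp only [map_smul, HardySpace.evalCLM_apply, heval, smul_eq_mul] at h1
    exact h1.unique (HardySpace.hasSum_coeffs f (UnitDisc.mk (φ (z : ℂ)) (hφ1 z)))
  · refine hsum.congr fun n => ?_
    congr 2
    set b := HilbertBasis.ofRepr HardySpace.coeffsIsometry with hb
    -- The `n`-th basis vector is `zⁿ`, which `T` sends to `eₙ = φⁿ`.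
    have hc : HardySpace.coeffs (b n) = lp.single 2 n (1 : ℂ) := b.repr_self n
    refine (hT (b n)).unique ?_ |>.symm
    rw [hc]
    convert hasSum_single n ?_ using 1
    · simp
    · intro m hm
      simp [lp.single_apply, hm]

/-! ### Discretizing a closed null set of the circle -/

/-- The `j`-th vertex of the regular `N`-gon on the circle, starting from `-1`. -/
noncomputable def gridPoint (N j : ℕ) : Circle :=
  Circle.exp (-Real.pi + 2 * Real.pi / N * j)

theorem norm_circleExp_sub_le (s t : ℝ) :
    ‖(Circle.exp s : ℂ) - (Circle.exp t : ℂ)‖ ≤ |s - t| := by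
  have h : (Circle.exp s : ℂ) - (Circle.exp t : ℂ)
      = Circle.exp t * (Complex.exp (I * ((s - t : ℝ) : ℂ)) - 1) := by
    simp only [Circle.coe_exp, mul_sub, ← Complex.exp_add, mul_one]
    congr 2
    push_cast
    ring
  rw [h, norm_mul, Circle.norm_coe, one_mul]
  exact Real.norm_exp_I_mul_ofReal_sub_one_le

/-- A closed null set of the circle is approximated at scale `2π / N` by a small proportion of the
vertices of a regular `N`-gon. -/
theorem exists_gridPoint_cover {E : Set Circle} (hE : IsClosed E) (hE0 : arcLength E = 0)
    {ε : ℝ} (hε : 0 < ε) :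
    ∃ N : ℕ, 0 < N ∧ ∃ J ⊆ Finset.range N, (J.card : ℝ) ≤ ε * N ∧
      (∀ j ∈ J, ∃ e ∈ E, ‖(gridPoint N j : ℂ) - e‖ ≤ 2 * Real.pi / N) ∧
      ∀ e ∈ E, ∃ j ∈ J, ‖(gridPoint N j : ℂ) - e‖ ≤ 2 * Real.pi / N := by
  classical
  have hpi := Real.pi_pos
  -- The closed interval makes `K` compact; the added endpoint `-π` is a null set.
  set K : Set ℝ := Icc (-Real.pi) Real.pi ∩ Circle.exp ⁻¹' E with hK
  have hKc : IsCompact K := isCompact_Icc.inter_right (hE.preimage Circle.exp.continuous)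
  have hK0 : volume K = 0 := by
    refine measure_mono_null (t := {t : ℝ | t ∈ Ioc (-Real.pi) Real.pi ∧ Circle.exp t ∈ E} ∪
      {-Real.pi}) ?_ (measure_union_null hE0 Real.volume_singleton)
    rintro t ⟨ht, htE⟩
    rcases ht.1.eq_or_lt with h | h
    · exact Or.inr h.symm
    · exact Or.inl ⟨⟨h, ht.2⟩, htE⟩
  -- Compactness is essential here: closed thickenings of `K` shrink to `K` in measure, so some
  -- scale `2π / N` has thickening of measure below `2πε`. The arcs of that length meeting `E` are
  -- disjoint and lie in the thickening.
  have hlim := tendsto_measure_cthickening_of_isCompact (μ := volume) hKc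
  rw [hK0] at hlim
  have hscale : Filter.Tendsto (fun N : ℕ => 2 * Real.pi / (N : ℝ)) Filter.atTop (nhds 0) :=
    tendsto_const_div_atTop_nhds_zero_nat _
  have hev := (hlim.comp hscale).eventually (gt_mem_nhds
    (ENNReal.ofReal_pos.mpr (by positivity : 0 < ε * (2 * Real.pi))))
  obtain ⟨N, hN, hN0⟩ := (hev.and (Filter.eventually_gt_atTop 0)).exists
  simp only [Function.comp] at hN
  have hNr : (0 : ℝ) < N := by exact_mod_cast hN0
  set θ : ℕ → ℝ := fun j => -Real.pi + 2 * Real.pi / N * j with hθ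
  have hθs : ∀ j, θ (j + 1) = θ j + 2 * Real.pi / N := fun j => by
    simp only [hθ]; push_cast; ring
  have hθm : Monotone θ := monotone_nat_of_le_succ fun j => by
    rw [hθs]; linarith [div_pos (by linarith : 0 < 2 * Real.pi) hNr]
  set J := (Finset.range N).filter fun j => ∃ t ∈ Ioc (θ j) (θ (j + 1)), Circle.exp t ∈ E with hJ
  have hθN : θ N = Real.pi := by simp only [hθ]; field_simp; ring
  have hθ0 : θ 0 = -Real.pi := by simp [hθ]
  refine ⟨N, hN0, J, Finset.filter_subset _ _, ?_, ?_, ?_⟩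
  · have hsub : (⋃ j ∈ J, Ioc (θ j) (θ (j + 1))) ⊆ cthickening (2 * Real.pi / N) K := by
      refine iUnion₂_subset fun j hj s hs => ?_
      obtain ⟨hjN, t, ht, htE⟩ := Finset.mem_filter.mp hj
      have htK : t ∈ K := by
        refine ⟨⟨?_, ?_⟩, htE⟩
        · rw [← hθ0]; exact (hθm (Nat.zero_le j)).trans ht.1.le
        · rw [← hθN]; exact ht.2.trans (hθm (Finset.mem_range.mp hjN))
      refine mem_cthickening_of_dist_le s t _ K htK ?_
      rw [Real.dist_eq, abs_le]
      rw [hθs] at hs ht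
      constructor <;> linarith [hs.1, hs.2, ht.1, ht.2]
    have hvol : volume (⋃ j ∈ J, Ioc (θ j) (θ (j + 1))) =
        ENNReal.ofReal (J.card * (2 * Real.pi / N)) := by
      have hdis : Pairwise (Function.onFun Disjoint fun j => Ioc (θ j) (θ (j + 1))) :=
        hθm.pairwise_disjoint_on_Ioc_succ
      rw [measure_biUnion_finset (hdis.set_pairwise _) fun _ _ => measurableSet_Ioc]
      simp only [Real.volume_Ioc, hθs, add_sub_cancel_left, Finset.sum_const, nsmul_eq_mul]
      rw [ENNReal.ofReal_mul (by positivity), ENNReal.ofReal_natCast]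
    have h := ((hvol ▸ measure_mono hsub).trans_lt hN)
    rw [ENNReal.ofReal_lt_ofReal_iff (by positivity)] at h
    have h2 : (J.card : ℝ) * (2 * Real.pi / N) = J.card / N * (2 * Real.pi) := by ring
    rw [h2] at h
    exact ((div_lt_iff₀ hNr).mp (lt_of_mul_lt_mul_right h (by positivity))).le
  · intro j hj
    obtain ⟨-, t, ht, htE⟩ := Finset.mem_filter.mp hj
    refine ⟨_, htE, (norm_circleExp_sub_le _ t).trans ?_⟩
    rw [hθs] at ht
    change |θ j - t| ≤ _
    rw [abs_le]
    constructor <;> linarith [ht.1, ht.2]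
  · intro e he
    set t := arg (e : ℂ) with ht
    have hte : Circle.exp t = e := Circle.exp_arg e
    have htu : t ∈ ⋃ j ∈ Ico 0 N, Ioc (θ j) (θ (j + 1)) := by
      have h := hθm.biUnion_Ico_Ioc_map_succ 0 N
      rw [hθ0, hθN] at h
      exact h.symm ▸ arg_mem_Ioc (e : ℂ)
    simp only [mem_iUnion] at htu
    obtain ⟨j, hjN, htj⟩ := htu
    refine ⟨j, Finset.mem_filter.mpr ⟨Finset.mem_range.mpr hjN.2, t, htj, hte ▸ he⟩, ?_⟩
    rw [← hte]
    refine (norm_circleExp_sub_le _ t).trans ?_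
    rw [hθs] at htj
    change |θ j - t| ≤ _
    rw [abs_le]
    constructor <;> linarith [htj.1, htj.2]

/-! ### Bump functions from Cauchy kernels -/

/-- Averaging the Cauchy kernel over the `N`-th roots of unity. -/
theorem IsPrimitiveRoot.sum_inv_one_sub {ω : ℂ} {N : ℕ} (hω : IsPrimitiveRoot ω N) (hN : 0 < N)
    {w : ℂ} (hw : ‖w‖ < 1) :
    ∑ j ∈ Finset.range N, (1 - ω ^ j * w)⁻¹ = N * (1 - w ^ N)⁻¹ := by
  have hω1 : ‖ω‖ = 1 := hω.norm'_eq_one hN.ne'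
  have h1 : ∀ j, 1 - ω ^ j * w ≠ 0 := fun j h => by
    have : ‖ω ^ j * w‖ = 1 := by rw [← sub_eq_zero.mp h, norm_one]
    rw [norm_mul, norm_pow, hω1, one_pow, one_mul] at this
    exact hw.ne this
  have h2 : 1 - w ^ N ≠ 0 := fun h => by
    have : ‖w ^ N‖ = 1 := by rw [← sub_eq_zero.mp h, norm_one]
    rw [norm_pow] at this
    exact (pow_lt_one₀ (norm_nonneg _) hw hN.ne').ne this
  have h3 : ∀ j, (1 - ω ^ j * w)⁻¹ =
      (∑ m ∈ Finset.range N, w ^ m * (ω ^ m) ^ j) * (1 - w ^ N)⁻¹ := by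
    intro j
    have hg := mul_neg_geom_sum (ω ^ j * w) N
    have hp : (ω ^ j * w) ^ N = w ^ N := by
      rw [mul_pow, pow_right_comm, hω.pow_eq_one, one_pow, one_mul]
    rw [hp] at hg
    have hs : ∑ m ∈ Finset.range N, w ^ m * (ω ^ m) ^ j
        = ∑ m ∈ Finset.range N, (ω ^ j * w) ^ m :=
      Finset.sum_congr rfl fun m _ => by rw [mul_pow, pow_right_comm, mul_comm]
    rw [hs, ← hg, mul_inv, mul_comm (1 - ω ^ j * w)⁻¹, ← mul_assoc, mul_inv_cancel₀, one_mul]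
    exact fun h => h2 (by rw [← hg, h, mul_zero])
  simp only [h3, ← Finset.sum_mul]
  congr 1
  rw [Finset.sum_comm]
  simp only [← Finset.mul_sum]
  rw [Finset.sum_eq_single_of_mem 0 (Finset.mem_range.mpr hN)]
  · simp
  · intro m hm hm0
    have hne : ω ^ m ≠ 1 := hω.pow_ne_one_of_pos_of_lt hm0 (Finset.mem_range.mp hm)
    rw [geom_sum_eq hne, pow_right_comm, hω.pow_eq_one, one_pow, sub_self, zero_div, mul_zero]

/-- The minus sign reflects that the polygon starts at `-1`; it is why the averaged kernel below has
`-(r z)` as its argument. -/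
theorem conj_gridPoint {N : ℕ} (j : ℕ) :
    starRingEnd ℂ (gridPoint N j : ℂ) = -((Complex.exp (2 * Real.pi * I / N))⁻¹ ^ j) := by
  rw [gridPoint, ← Circle.coe_inv_eq_conj, ← Circle.exp_neg, Circle.coe_exp, inv_pow,
    ← Complex.exp_nat_mul, ← Complex.exp_neg, neg_eq_neg_one_mul (Complex.exp _),
    ← Complex.exp_pi_mul_I, ← Complex.exp_add]
  congr 1
  push_cast
  ring

theorem re_inv_one_sub_nonneg {w : ℂ} (hw : ‖w‖ ≤ 1) : 0 ≤ ((1 - w)⁻¹).re := by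
  rw [Complex.inv_re]
  refine div_nonneg ?_ (Complex.normSq_nonneg _)
  simp only [sub_re, one_re]
  linarith [Complex.re_le_norm w]

/-- For a closed null set `E` of the circle and `ε > 0`, a function in the disc algebra whose real
part lies in `[0, 2]` and is bounded below on `E`, and which is of size `ε` away from `E`. -/
theorem exists_disc_algebra_bump {E : Set Circle} (hE : IsClosed E) (hE0 : arcLength E = 0)
    {ε : ℝ} (hε : 0 < ε) :
    ∃ f : ℂ → ℂ, DifferentiableOn ℂ f (ball 0 1) ∧ ContinuousOn f (closedBall 0 1) ∧
      (∀ z ∈ closedBall (0 : ℂ) 1, 0 ≤ (f z).re ∧ (f z).re ≤ 2) ∧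
      (∀ e ∈ E, 1 / 64 ≤ (f (e : ℂ)).re) ∧
      ∀ z ∈ closedBall (0 : ℂ) 1, ∀ d, (∀ e ∈ E, d ≤ ‖z - (e : ℂ)‖) → d * ‖f z‖ ≤ 9 * ε := by
  obtain ⟨N, hN, J, hJN, hcard, hJE, hEJ⟩ := exists_gridPoint_cover hE hE0 hε
  have hNr : (0 : ℝ) < N := by exact_mod_cast hN
  have hN1 : (1 : ℝ) ≤ N := by exact_mod_cast hN
  -- The kernels have their poles at distance comparable to `1 / N` outside the disc, the scale of
  -- the grid, so that one kernel has size about `N` at its vertex and outweighs the factor `1 / N`.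
  set r : ℝ := 1 - 1 / N with hr
  have hr0 : 0 ≤ r := by rw [hr, sub_nonneg, div_le_one hNr]; exact hN1
  have hinv : 0 < 1 / (N : ℝ) := by positivity
  have hr1 : r < 1 := by linarith
  set w : ℕ → ℂ → ℂ := fun j z => r * (starRingEnd ℂ (gridPoint N j : ℂ) * z) with hw
  have hcz : ∀ j z, z ∈ closedBall (0 : ℂ) 1 → ‖starRingEnd ℂ (gridPoint N j : ℂ) * z‖ ≤ 1 := by
    intro j z hz
    rw [norm_mul, Complex.norm_conj, Circle.norm_coe, one_mul]
    simpa using hz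
  have hwn : ∀ j z, z ∈ closedBall (0 : ℂ) 1 → ‖w j z‖ ≤ r := by
    intro j z hz
    simp only [hw]
    rw [norm_mul, Complex.norm_real, Real.norm_of_nonneg hr0]
    exact mul_le_of_le_one_right hr0 (hcz j z hz)
  have hlow : ∀ j z, z ∈ closedBall (0 : ℂ) 1 → 1 / (N : ℝ) ≤ ‖1 - w j z‖ := by
    intro j z hz
    have h := norm_sub_norm_le 1 (w j z)
    rw [norm_one] at h
    linarith [hwn j z hz]
  have hne : ∀ j z, z ∈ closedBall (0 : ℂ) 1 → 1 - w j z ≠ 0 := fun j z hz =>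
    norm_pos_iff.mp (hinv.trans_le (hlow j z hz))
  have hdist : ∀ j z, ‖1 - starRingEnd ℂ (gridPoint N j : ℂ) * z‖ = ‖z - gridPoint N j‖ := by
    intro j z
    have h : (gridPoint N j : ℂ) * starRingEnd ℂ (gridPoint N j : ℂ) = 1 := by
      rw [Complex.mul_conj, Circle.normSq_coe]; simp
    have h2 : z - gridPoint N j =
        -(gridPoint N j : ℂ) * (1 - starRingEnd ℂ (gridPoint N j : ℂ) * z) := by
      linear_combination (-z) * h
    rw [h2, norm_mul, norm_neg, Circle.norm_coe, one_mul]
  set f : ℂ → ℂ := fun z => ((1 / N : ℝ) : ℂ) * ∑ j ∈ J, (1 - w j z)⁻¹ with hf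
  have hre : ∀ z, (f z).re = 1 / N * ∑ j ∈ J, ((1 - w j z)⁻¹).re := fun z => by
    simp only [hf, Complex.re_ofReal_mul, Complex.re_sum]
  have hwd : ∀ j, Differentiable ℂ (w j) := fun j => by simp only [hw]; fun_prop
  have hnn : ∀ j z, z ∈ closedBall (0 : ℂ) 1 → 0 ≤ ((1 - w j z)⁻¹).re := fun j z hz =>
    re_inv_one_sub_nonneg ((hwn j z hz).trans hr1.le)
  have hdiff : DifferentiableOn ℂ f (closedBall 0 1) := by
    refine DifferentiableOn.const_mul (DifferentiableOn.fun_sum fun j _ => ?_) _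
    exact ((hwd j).const_sub 1).differentiableOn.inv fun z hz => hne j z hz
  refine ⟨f, hdiff.mono ball_subset_closedBall, hdiff.continuousOn, fun z hz => ⟨?_, ?_⟩, ?_, ?_⟩
  · rw [hre]
    exact mul_nonneg hinv.le (Finset.sum_nonneg fun j _ => hnn j z hz)
  -- Real parts are nonnegative, so the sum over `J` is at most the sum over all vertices, which is
  -- `N / (1 - (-rz)^N)` before taking real parts. Here `r^N ≤ 1/e ≤ 1/2`.
  · have hω : IsPrimitiveRoot (Complex.exp (2 * Real.pi * I / N))⁻¹ N :=
      (Complex.isPrimitiveRoot_exp N hN.ne').inv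
    have hzn : ‖-(r * z)‖ ≤ r := by
      rw [norm_neg, norm_mul, Complex.norm_real, Real.norm_of_nonneg hr0]
      exact mul_le_of_le_one_right hr0 (by simpa using hz)
    have hsum := hω.sum_inv_one_sub hN (hzn.trans_lt hr1)
    have hle : ∑ j ∈ J, ((1 - w j z)⁻¹).re ≤ ∑ j ∈ Finset.range N, ((1 - w j z)⁻¹).re :=
      Finset.sum_le_sum_of_subset_of_nonneg hJN fun j _ _ => hnn j z hz
    have heq : ∑ j ∈ Finset.range N, (1 - w j z)⁻¹ = N * (1 - (-(r * z)) ^ N)⁻¹ := by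
      rw [← hsum]
      refine Finset.sum_congr rfl fun j _ => ?_
      simp only [hw, conj_gridPoint]
      congr 2
      ring
    have hpow : ‖(-(r * z)) ^ N‖ ≤ 1 / 2 := by
      rw [norm_pow]
      refine (pow_le_pow_left₀ (norm_nonneg _) hzn N).trans ?_
      refine (Real.one_sub_div_pow_le_exp_neg hN1).trans ?_
      rw [Real.exp_neg, ← one_div]
      exact one_div_le_one_div_of_le two_pos (by linarith [Real.add_one_le_exp 1])
    have hbd : ((1 - (-(r * z)) ^ N)⁻¹).re ≤ 2 := by
      refine (Complex.re_le_norm _).trans ?_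
      rw [norm_inv]
      refine inv_le_of_inv_le₀ two_pos ?_
      have h := norm_sub_norm_le 1 ((-(r * z)) ^ N)
      rw [norm_one] at h
      linarith
    rw [hre]
    refine (mul_le_mul_of_nonneg_left hle hinv.le).trans ?_
    rw [← Complex.re_sum, heq, ← Complex.ofReal_natCast, Complex.re_ofReal_mul, ← mul_assoc,
      one_div_mul_cancel hNr.ne', one_mul]
    exact hbd
  · intro e he
    have hez : (e : ℂ) ∈ closedBall (0 : ℂ) 1 := by
      rw [mem_closedBall_zero_iff, Circle.norm_coe]
    obtain ⟨j, hj, hje⟩ := hEJ e he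
    -- The constant is `1 + 2π < 8`.
    have hup : ‖1 - w j e‖ ≤ 8 / N := by
      have h : 1 - w j e = ((1 / N : ℝ) : ℂ) + r * (1 - starRingEnd ℂ (gridPoint N j : ℂ) * e) := by
        simp only [hw, hr]; push_cast; ring
      rw [h]
      refine (norm_add_le _ _).trans ?_
      rw [norm_mul, Complex.norm_real, Complex.norm_real, Real.norm_of_nonneg hinv.le,
        Real.norm_of_nonneg hr0, hdist, norm_sub_rev]
      have h1 : r * ‖(gridPoint N j : ℂ) - e‖ ≤ 2 * Real.pi / N :=
        (mul_le_of_le_one_left (norm_nonneg _) hr1.le).trans hje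
      have h2 : 1 / (N : ℝ) + 2 * Real.pi / N ≤ 8 / N := by
        rw [← add_div]
        exact div_le_div_of_nonneg_right (by linarith [Real.pi_lt_d2]) hNr.le
      linarith
    -- `Re (1 - w)⁻¹ = Re (1 - w) / |1 - w|²`, with numerator at least `1 / N` and denominator at
    -- most `(8 / N)²`.
    have hterm : (N : ℝ) / 64 ≤ ((1 - w j e)⁻¹).re := by
      rw [Complex.inv_re, ← Complex.sq_norm,
        le_div_iff₀ (pow_pos (hinv.trans_le (hlow j e hez)) 2)]
      have h1 : 1 / (N : ℝ) ≤ (1 - w j e).re := by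
        simp only [sub_re, one_re]
        linarith [Complex.re_le_norm (w j e), hwn j e hez]
      refine le_trans ?_ h1
      have h2 : ‖1 - w j e‖ ^ 2 ≤ (8 / N) ^ 2 := pow_le_pow_left₀ (norm_nonneg _) hup 2
      refine (mul_le_mul_of_nonneg_left h2 (by positivity)).trans (le_of_eq ?_)
      field_simp
      norm_num
    rw [hre]
    have hsingle := Finset.single_le_sum (f := fun j => ((1 - w j (e : ℂ))⁻¹).re)
      (fun j _ => hnn j e hez) hj
    have h := mul_le_mul_of_nonneg_left (hterm.trans hsingle) hinv.le
    refine le_trans (le_of_eq ?_) h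
    field_simp
  · intro z hz d hd
    have hterm : ∀ j ∈ J, d * ‖(1 - w j z)⁻¹‖ ≤ 9 := by
      intro j hj
      obtain ⟨e, he, hje⟩ := hJE j hj
      have hpos := hinv.trans_le (hlow j z hz)
      rw [norm_inv, ← div_eq_mul_inv, div_le_iff₀ hpos]
      have h1 : d ≤ ‖z - gridPoint N j‖ + 2 * Real.pi / N :=
        (hd e he).trans ((norm_sub_le_norm_sub_add_norm_sub z (gridPoint N j) e).trans
          (by linarith))
      have h2 : ‖z - gridPoint N j‖ ≤ ‖1 - w j z‖ + 1 / N := by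
        have h : 1 - starRingEnd ℂ (gridPoint N j : ℂ) * z =
            (1 - w j z) - ((1 / N : ℝ) : ℂ) * (starRingEnd ℂ (gridPoint N j : ℂ) * z) := by
          simp only [hw, hr]; push_cast; ring
        rw [← hdist, h]
        refine (norm_sub_le _ _).trans (add_le_add_right ?_ _)
        rw [norm_mul, Complex.norm_real, Real.norm_of_nonneg hinv.le]
        exact mul_le_of_le_one_right hinv.le (hcz j z hz)
      have h3 : 2 * Real.pi / N = 2 * Real.pi * (1 / N) := by ring
      rw [h3] at h1
      -- Since `1 / N ≤ |1 - w|`, the bounds add up to `d ≤ (2 + 2π)|1 - w|`, and `2 + 2π < 9`.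
      nlinarith [hlow j z hz, Real.pi_lt_d2, Real.pi_pos]
    rcases le_or_gt d 0 with hd0 | hd0
    · exact (mul_nonpos_of_nonpos_of_nonneg hd0 (norm_nonneg _)).trans (by positivity)
    · have h1 : ‖f z‖ ≤ 1 / N * ∑ j ∈ J, ‖(1 - w j z)⁻¹‖ := by
        simp only [hf]
        rw [norm_mul, Complex.norm_real, Real.norm_of_nonneg hinv.le]
        exact mul_le_mul_of_nonneg_left (norm_sum_le _ _) hinv.le
      calc d * ‖f z‖ ≤ d * (1 / N * ∑ j ∈ J, ‖(1 - w j z)⁻¹‖) :=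
            mul_le_mul_of_nonneg_left h1 hd0.le
        _ = 1 / N * ∑ j ∈ J, d * ‖(1 - w j z)⁻¹‖ := by rw [← Finset.mul_sum]; ring
        _ ≤ 1 / N * (J.card * 9) := by
            refine mul_le_mul_of_nonneg_left ?_ hinv.le
            exact (Finset.sum_le_sum hterm).trans (by simp)
        _ ≤ 1 / N * (ε * N * 9) := by gcongr
        _ = 9 * ε := by field_simp

/-! ### Summing the bumps -/

/-- A series of functions on the closed disc whose terms are `O(2⁻ᵏ / dist(z, S))` converges away
from the closed set `S`, locally uniformly. -/
theorem series_away_from_closed {S : Set ℂ} (hS : IsClosed S) {g : ℕ → ℂ → ℂ} {C : ℝ}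
    (hc : ∀ k, ContinuousOn (g k) (closedBall 0 1))
    (hb : ∀ k, ∀ z ∈ closedBall (0 : ℂ) 1, ∀ d, (∀ e ∈ S, d ≤ ‖z - e‖) →
      d * ‖g k z‖ ≤ C * (1 / 2) ^ k) :
    (∀ z ∈ closedBall (0 : ℂ) 1 \ S, Summable fun k => g k z) ∧
      ContinuousOn (fun z => ∑' k, g k z) (closedBall 0 1 \ S) ∧
      ∀ U ⊆ closedBall (0 : ℂ) 1 \ S, IsOpen U → (∀ k, DifferentiableOn ℂ (g k) U) →
        DifferentiableOn ℂ (fun z => ∑' k, g k z) U := by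
  have hloc : ∀ z ∉ S, ∃ d > 0, ∀ x ∈ ball z d, x ∈ closedBall (0 : ℂ) 1 →
      ∀ k, ‖g k x‖ ≤ C / d * (1 / 2) ^ k := by
    intro z hz
    obtain ⟨δ, hδ, hδS⟩ := Metric.isOpen_iff.mp hS.isOpen_compl z hz
    refine ⟨δ / 2, by positivity, fun x hx hx1 k => ?_⟩
    have h := hb k x hx1 (δ / 2) fun e he => by
      have h1 : δ ≤ dist e z := by
        by_contra! hlt
        exact hδS hlt he
      have h2 := dist_triangle e x z
      rw [mem_ball] at hx
      rw [← dist_eq_norm, dist_comm]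
      linarith
    rw [div_mul_eq_mul_div, le_div_iff₀ (by positivity), mul_comm]
    exact h
  have hgeom : ∀ a : ℝ, Summable fun k : ℕ => a * (1 / 2 : ℝ) ^ k := fun a =>
    summable_geometric_two.mul_left a
  refine ⟨fun z hz => ?_, fun z hz => ?_, fun U hU hUo hd z hz => ?_⟩
  · obtain ⟨d, hd, h⟩ := hloc z hz.2
    exact Summable.of_norm_bounded (hgeom _) (h z (mem_ball_self hd) hz.1)
  · obtain ⟨d, hd, h⟩ := hloc z hz.2
    have hcont : ContinuousOn (fun z => ∑' k, g k z) ((closedBall 0 1 \ S) ∩ ball z d) :=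
      continuousOn_tsum (fun k => (hc k).mono fun x hx => hx.1.1) (hgeom (C / d))
        fun k x hx => h x hx.2 hx.1.1 k
    have hw := hcont z ⟨hz, mem_ball_self hd⟩
    rwa [continuousWithinAt_inter (ball_mem_nhds z hd)] at hw
  · obtain ⟨d, hd', h⟩ := hloc z (hU hz).2
    have hdiff : DifferentiableOn ℂ (fun z => ∑' k, g k z) (U ∩ ball z d) :=
      differentiableOn_tsum_of_summable_norm (hgeom (C / d))
        (fun k => (hd k).mono inter_subset_left) (hUo.inter isOpen_ball)
        fun k x hx => h x hx.2 (hU hx.1).1 k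
    have hmem : U ∩ ball z d ∈ nhds z :=
      (hUo.inter isOpen_ball).mem_nhds ⟨hz, mem_ball_self hd'⟩
    exact (hdiff.differentiableAt hmem).differentiableWithinAt

/-- With `s` the sum of the first `K` terms, adding `u K` increases the square by `u K * (2 + 2s + u
K)`. Since `s ≤ 2K` and `u K ≤ 2`, the bracket is at most `4K + 4`, which is the origin of these
weights. -/
theorem sq_one_add_sum_le {u : ℕ → ℝ} (h0 : ∀ k, 0 ≤ u k) (h2 : ∀ k, u k ≤ 2) (K : ℕ) :
    (1 + ∑ k ∈ Finset.range K, u k) ^ 2 ≤ 1 + ∑ k ∈ Finset.range K, (4 * k + 4) * u k := by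
  induction K with
  | zero => simp
  | succ K ih =>
    rw [Finset.sum_range_succ, Finset.sum_range_succ]
    have hs : ∑ k ∈ Finset.range K, u k ≤ 2 * K :=
      (Finset.sum_le_sum fun k _ => h2 k).trans (by simp [mul_comm])
    nlinarith [h0 K, h2 K, mul_nonneg (h0 K) (sub_nonneg.mpr hs),
      mul_nonneg (h0 K) (sub_nonneg.mpr (h2 K))]

/-- `|2F - 1|² = 4|F|² - 4 Re F + 1 ≤ 4|F|² - 3`; divide by `|2F|²`. -/
theorem norm_sq_one_sub_inv_le {F : ℂ} (hF : 1 ≤ F.re) :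
    ‖1 - (2 * F)⁻¹‖ ^ 2 ≤ 1 - 3 / 4 * (‖F‖ ^ 2)⁻¹ := by
  have hF0 : F ≠ 0 := fun h => by rw [h, zero_re] at hF; linarith
  have hpos : 0 < ‖F‖ ^ 2 := by positivity
  have h1 : 1 - (2 * F)⁻¹ = (2 * F - 1) / (2 * F) := by field_simp
  have h2 : ‖2 * F - 1‖ ^ 2 = 4 * ‖F‖ ^ 2 - 4 * F.re + 1 := by
    simp only [Complex.sq_norm, Complex.normSq_apply]
    simp
    ring
  rw [h1, norm_div, div_pow, h2, norm_mul, mul_pow,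
    div_le_iff₀ (mul_pos (by norm_num) hpos)]
  have h3 : (1 - 3 / 4 * (‖F‖ ^ 2)⁻¹) * (‖(2 : ℂ)‖ ^ 2 * ‖F‖ ^ 2) = 4 * ‖F‖ ^ 2 - 3 := by
    rw [Complex.norm_ofNat]
    field_simp
    ring
  rw [h3]
  linarith

/-! ### Construction of the symbol -/

theorem mainTheorem3 (E : Set Circle) (hE : IsClosed E) (hE0 : arcLength E = 0) :
    ∃ φ : ℂ → ℂ, MemDiscAlgebra φ ∧
      ∃ hφ : ∀ z : UnitDisc, ‖φ (z : ℂ)‖ < 1,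
        (∃ T : HardySpace →L[ℂ] HardySpace, IsCompositionOperator φ hφ T ∧ IsHilbertSchmidt T) ∧
        levelSet φ 1 = E := by
  classical
  -- The denominator `4k + 4` absorbs the weights of `G`, leaving a geometric bound for both series.
  choose f hfd hfc hfre hfE hfb using fun k : ℕ =>
    exists_disc_algebra_bump hE hE0 (ε := (1 / 2) ^ k / (4 * k + 4)) (by positivity)
  set S : Set ℂ := (fun e : Circle => (e : ℂ)) '' E with hSdef
  have hS : IsClosed S := (hE.isCompact.image continuous_subtype_val).isClosed
  have hSn : ∀ z ∈ S, ‖z‖ = 1 := by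
    rintro _ ⟨e, -, rfl⟩
    exact Circle.norm_coe e
  have hball : ball (0 : ℂ) 1 ⊆ closedBall 0 1 \ S := fun z hz =>
    ⟨ball_subset_closedBall hz, fun h => by
      rw [mem_ball_zero_iff, hSn z h] at hz; exact lt_irrefl _ hz⟩
  set g : ℕ → ℂ → ℂ := fun k z => ((4 * k + 4 : ℝ) : ℂ) * f k z with hg
  have hgb : ∀ k, ∀ z ∈ closedBall (0 : ℂ) 1, ∀ d, (∀ e ∈ S, d ≤ ‖z - e‖) →
      d * ‖g k z‖ ≤ 9 * (1 / 2) ^ k := by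
    intro k z hz d hd
    have h := hfb k z hz d fun e he => hd e ⟨e, he, rfl⟩
    have hk : (0 : ℝ) < 4 * k + 4 := by positivity
    simp only [hg]
    rw [norm_mul, Complex.norm_real, Real.norm_of_nonneg hk.le]
    calc d * ((4 * k + 4) * ‖f k z‖) = (4 * k + 4) * (d * ‖f k z‖) := by ring
      _ ≤ (4 * k + 4) * (9 * ((1 / 2) ^ k / (4 * k + 4))) := mul_le_mul_of_nonneg_left h hk.le
      _ = 9 * (1 / 2) ^ k := by field_simp
  have hfb' : ∀ k, ∀ z ∈ closedBall (0 : ℂ) 1, ∀ d, (∀ e ∈ S, d ≤ ‖z - e‖) →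
      d * ‖f k z‖ ≤ 9 * (1 / 2) ^ k := by
    intro k z hz d hd
    refine (hfb k z hz d fun e he => hd e ⟨e, he, rfl⟩).trans ?_
    refine mul_le_mul_of_nonneg_left (div_le_self (by positivity) ?_) (by norm_num)
    have : (0 : ℝ) ≤ k := k.cast_nonneg
    linarith
  have hgc : ∀ k, ContinuousOn (g k) (closedBall 0 1) := fun k => continuousOn_const.mul (hfc k)
  have hgd : ∀ k, DifferentiableOn ℂ (g k) (ball 0 1) := fun k => (hfd k).const_mul _
  obtain ⟨hfs, hFc, hFd⟩ := series_away_from_closed hS hfc hfb'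
  obtain ⟨hgs, -, hGd⟩ := series_away_from_closed hS hgc hgb
  set F : ℂ → ℂ := fun z => 1 + ∑' k, f k z with hF
  set G : ℂ → ℂ := fun z => 1 + ∑' k, g k z with hG
  have hFball : DifferentiableOn ℂ F (ball 0 1) := (hFd _ hball isOpen_ball hfd).const_add 1
  have hGball : DifferentiableOn ℂ G (ball 0 1) := (hGd _ hball isOpen_ball hgd).const_add 1
  have hsumF : ∀ z ∈ closedBall (0 : ℂ) 1 \ S, HasSum (fun k => (f k z).re) ((F z).re - 1) := by
    intro z hz
    have h := Complex.hasSum_re (hfs z hz).hasSum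
    simpa [hF] using h
  have hsumG : ∀ z ∈ closedBall (0 : ℂ) 1 \ S,
      HasSum (fun k : ℕ => (4 * k + 4 : ℝ) * (f k z).re) ((G z).re - 1) := by
    intro z hz
    have h := Complex.hasSum_re (hgs z hz).hasSum
    simp only [hg, Complex.re_ofReal_mul] at h
    simpa [hG, hg] using h
  have hpartial : ∀ z ∈ closedBall (0 : ℂ) 1 \ S, ∀ K,
      1 + ∑ k ∈ Finset.range K, (f k z).re ≤ (F z).re := by
    intro z hz K
    have h := sum_le_hasSum (Finset.range K) (fun k _ => (hfre k z hz.1).1) (hsumF z hz)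
    linarith
  have hF1 : ∀ z ∈ closedBall (0 : ℂ) 1 \ S, 1 ≤ (F z).re := fun z hz => by
    simpa using hpartial z hz 0
  have hFG : ∀ z ∈ closedBall (0 : ℂ) 1 \ S, (F z).re ^ 2 ≤ (G z).re := by
    intro z hz
    have h1 := ((hsumF z hz).tendsto_sum_nat.const_add 1).pow 2
    have h2 := (hsumG z hz).tendsto_sum_nat.const_add 1
    rw [add_sub_cancel] at h1 h2
    exact le_of_tendsto_of_tendsto' h1 h2 fun K =>
      sq_one_add_sum_le (fun k => (hfre k z hz.1).1) (fun k => (hfre k z hz.1).2) K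
  have hF0 : ∀ z ∈ closedBall (0 : ℂ) 1 \ S, 2 * F z ≠ 0 := fun z hz h => by
    have h1 := hF1 z hz
    rw [(mul_eq_zero.mp h).resolve_left two_ne_zero, zero_re] at h1
    linarith
  set φ : ℂ → ℂ := fun z => if z ∈ S then 1 else 1 - (2 * F z)⁻¹ with hφ
  have hφS : ∀ z ∈ S, φ z = 1 := fun z hz => if_pos hz
  have hφF : ∀ z ∉ S, φ z = 1 - (2 * F z)⁻¹ := fun z hz => if_neg hz
  have hφle : ∀ z ∈ closedBall (0 : ℂ) 1 \ S, ‖φ z‖ ^ 2 ≤ 1 - 3 / 4 * (‖F z‖ ^ 2)⁻¹ := by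
    intro z hz
    rw [hφF z hz.2]
    exact norm_sq_one_sub_inv_le (hF1 z hz)
  have hFpos : ∀ z ∈ closedBall (0 : ℂ) 1 \ S, 0 < ‖F z‖ ^ 2 := fun z hz =>
    pow_pos (one_pos.trans_le ((hF1 z hz).trans (Complex.re_le_norm _))) 2
  have hφ1 : ∀ z ∈ closedBall (0 : ℂ) 1 \ S, ‖φ z‖ < 1 := by
    intro z hz
    have h := hφle z hz
    have h2 := inv_pos.mpr (hFpos z hz)
    exact lt_of_pow_lt_pow_left₀ 2 zero_le_one (by linarith)
  have hφd : DifferentiableOn ℂ φ (ball 0 1) := by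
    have h : DifferentiableOn ℂ (fun z => 1 - (2 * F z)⁻¹) (ball 0 1) :=
      ((hFball.const_mul 2).inv fun z hz => hF0 z (hball hz)).const_sub 1
    exact h.congr fun z hz => hφF z (hball hz).2
  have hφc : ContinuousOn φ (closedBall 0 1) := by
    intro z hz
    by_cases hzS : z ∈ S
    · rw [ContinuousWithinAt, hφS z hzS, Metric.tendsto_nhds]
      intro η hη
      -- At a point of `S` the first `K` terms already contribute at least `K / 64` to the real
      -- part. This finite sum is continuous, so nearby `|F| > K / 64` off `S`, and `|φ - 1| = 1 /
      -- (2|F|) < 32 / K < η`.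
      obtain ⟨K, hK⟩ := exists_nat_gt (32 / η)
      have hKpos : (0 : ℝ) < K := (by positivity : (0 : ℝ) < 32 / η).trans hK
      have hcont : ContinuousOn (fun x => 1 + ∑ k ∈ Finset.range K, (f k x).re)
          (closedBall 0 1) :=
        continuousOn_const.add (continuousOn_finsetSum _ fun k _ =>
          Complex.continuous_re.comp_continuousOn (hfc k))
      have hval : (K : ℝ) / 64 < 1 + ∑ k ∈ Finset.range K, (f k z).re := by
        obtain ⟨e, he, rfl⟩ := hzS
        have h := Finset.card_nsmul_le_sum (Finset.range K) (fun k => (f k (e : ℂ)).re) (1 / 64)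
          fun k _ => hfE k e he
        rw [Finset.card_range, nsmul_eq_mul] at h
        linarith
      filter_upwards [(hcont z hz).eventually (lt_mem_nhds hval), self_mem_nhdsWithin] with x hx hx1
      by_cases hxS : x ∈ S
      · rw [hφS x hxS, dist_self]; exact hη
      · have h1 := hpartial x ⟨hx1, hxS⟩ K
        have h2 : (K : ℝ) / 64 < ‖F x‖ := hx.trans_le (h1.trans (Complex.re_le_norm _))
        have h3 : dist (φ x) 1 = (2 * ‖F x‖)⁻¹ := by
          rw [hφF x hxS, dist_eq_norm, sub_sub_cancel_left, norm_neg, norm_inv, norm_mul,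
            Complex.norm_ofNat]
        rw [h3]
        rw [div_lt_iff₀ hη] at hK
        refine inv_lt_of_inv_lt₀ hη ?_
        rw [inv_lt_iff_one_lt_mul₀ hη]
        nlinarith
    · have h : ContinuousOn (fun z => 1 - (2 * F z)⁻¹) (closedBall 0 1 \ S) :=
        continuousOn_const.sub
          ((continuousOn_const.mul (continuousOn_const.add hFc)).inv₀ hF0)
      have hw : ContinuousWithinAt φ (closedBall 0 1 \ S) z :=
        (h z ⟨hz, hzS⟩).congr (fun x hx => hφF x hx.2) (hφF z hzS)
      rw [sdiff_eq, continuousWithinAt_inter (hS.isOpen_compl.mem_nhds hzS)] at hw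
      exact hw
  have hdisc : ∀ z : 𝔻, ‖φ (z : ℂ)‖ < 1 := fun z =>
    hφ1 z (hball (by simpa using z.norm_lt_one))
  refine ⟨φ, ⟨hφd, hφc⟩, hdisc, ?_, ?_⟩
  · refine exists_isHilbertSchmidt_of_harmonic_majorant hφd hdisc
      -- `|F|² = 2 (Re F)² - Re (F²) ≤ Re (2G - F²)`; the factor `4/3` inverts the `3/4` in the
      -- bound for `|φ|²`.
      (H := fun z => ((4 / 3 : ℝ) : ℂ) * (((2 : ℝ) : ℂ) * G z - F z ^ 2))
      (((hGball.const_mul _).sub (hFball.pow 2)).const_mul _) fun z hz => ?_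
    have hz' := hball hz
    have hnorm : ‖F z‖ ^ 2 = 2 * (F z).re ^ 2 - (F z ^ 2).re := by
      rw [Complex.sq_norm, Complex.normSq_apply, pow_two (F z), Complex.mul_re]
      ring
    have hlow : 3 / 4 * (‖F z‖ ^ 2)⁻¹ ≤ 1 - ‖φ z‖ ^ 2 := by linarith [hφle z hz']
    have hpos := hFpos z hz'
    have h1 : (1 - ‖φ z‖ ^ 2)⁻¹ ≤ 4 / 3 * ‖F z‖ ^ 2 := by
      refine (inv_anti₀ (by positivity) hlow).trans (le_of_eq ?_)
      rw [mul_inv, inv_inv, inv_div]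
    rw [Complex.re_ofReal_mul, Complex.sub_re, Complex.re_ofReal_mul]
    linarith [hFG z hz']
  · ext ζ
    have hζ : (ζ : ℂ) ∈ closedBall (0 : ℂ) 1 := by
      rw [mem_closedBall_zero_iff, Circle.norm_coe]
    have hmem : (ζ : ℂ) ∈ S ↔ ζ ∈ E := Subtype.val_injective.mem_set_image
    rw [levelSet, mem_ofPred_eq, ← hmem]
    constructor
    · intro h
      by_contra hn
      exact absurd (hφ1 ζ ⟨hζ, hn⟩) (not_lt.mpr h)
    · intro h
      rw [hφS _ h, norm_one]
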